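/- Let $D\ge 1$ and let $X$ be a real $(2,D)$-smooth Banach space, i.e. $\|x+y\|^2+\|x-y\|^2\le 2\|x\|^2+2D^2\|y\|^2$ for all $x,y\in X$. Let $(\mathscr F_j)_{j=0}^k$ be a finite filtration on a probability space $(\Omega,\mathscr F,\mathbb P)$ and write $\mathbb E_j:=\mathbb E(\,\cdot\,|\mathscr F_j)$. Suppose that $(f_j)_{j=0}^k$ is an adapted sequence of (strongly measurable) $X$-valued random variables, $(g_j)_{j=0}^k$ is an $X$-valued martingale, and $(V_j)_{j=1}^k$ is a strongly predictable sequence of random contractions on $X$ (i.e. each $V_j(\omega)$ is a bounded linear operator on $X$ of norm at most $1$, and $V_jx$ is strongly $\mathscr F_{j-1}$-measurable for all $x\in X$), such that, almost surely, $f_0=g_0=0$ and $$f_j=V_jf_{j-1}+dg_j,\qquad dg_j:=g_j-g_{j-1},\qquad j=1,\dots,k.$$ Put $$f^\star:=\max_{0\le j\le k}\|f_j\|,\qquad s(g):=\Bigl(\sum_{j=1}^k\mathbb E_{j-1}\|dg_j\|^2\Bigr)^{1/2}\in[0,\infty],\qquad \|Z\|_p:=(\mathbb E|Z|^p)^{1/p}\in[0,\infty].$$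 Then for all $0<p<2$, $$\|f^\star\|_p\le(300D)^{2/p}\,\|s(g)\|_p .$$ If, moreover, $(g_j)_{j=0}^k$ has conditionally symmetric increments, i.e. for all $1\le j\le k$ and all Borel sets $B\subseteq X$ one has $\mathbb E_{j-1}\mathbf 1_{\{dg_j\in B\}}=\mathbb E_{j-1}\mathbf 1_{\{-dg_j\in B\}}$ almost surely, then $$\|f^\star\|_p\le(100D)^{2/p}\,\|s(g)\|_p .$$ -/

import Mathlib

open MeasureTheory ProbabilityTheory
open scoped ENNReal

/-- A real normed space `X` is `(2, D)`-smooth if `D ≥ 1` and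
`‖x + y‖² + ‖x - y‖² ≤ 2 ‖x‖² + 2 D² ‖y‖²` for all `x, y`. -/
def IsTwoSmooth (X : Type*) [NormedAddCommGroup X] (D : ℝ) : Prop :=
  1 ≤ D ∧ ∀ x y : X, ‖x + y‖ ^ 2 + ‖x - y‖ ^ 2 ≤ 2 * ‖x‖ ^ 2 + 2 * D ^ 2 * ‖y‖ ^ 2

section Sequences

variable {Ω X : Type*} [NormedAddCommGroup X] {k : ℕ}

/-- The difference sequence of `g = (g_0, …, g_k)`. The entry with index `j : Fin k` is
`g_{j+1} - g_j`. -/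
def diffSeq (g : Fin (k + 1) → Ω → X) (j : Fin k) (ω : Ω) : X :=
  g j.succ ω - g j.castSucc ω

/-- The maximal function `f⋆ = max_{0 ≤ i ≤ k} ‖f_i‖`. -/
noncomputable def maxFun (f : Fin (k + 1) → Ω → X) (ω : Ω) : ℝ :=
  Finset.univ.sup' Finset.univ_nonempty fun i => ‖f i ω‖

/-- The conditional square function
`s(g) = (∑_{j=1}^k E(‖g_j - g_{j-1}‖² | ℱ_{j-1}))^{1/2}`, with values in `[0, ∞]`.
`condLExp` is the conditional expectation of a `[0, ∞]`-valued random variable, so no square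
integrability of the increments is needed for this to be meaningful. -/
noncomputable def condSquareFun {m : MeasurableSpace Ω} (μ : Measure Ω)
    (ℱ : Filtration (Fin (k + 1)) m) (g : Fin (k + 1) → Ω → X) (ω : Ω) : ℝ≥0∞ :=
  (∑ j : Fin k, condLExp (ℱ j.castSucc) μ (fun ω' => ‖diffSeq g j ω'‖ₑ ^ 2) ω) ^ (1 / 2 : ℝ)

/-- `ξ` and `η` are conditionally equi-distributed given the `σ`-algebra `𝒢`:
`E(1_{ξ ∈ B} | 𝒢) = E(1_{η ∈ B} | 𝒢)` almost surely, for all Borel sets `B`. -/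
def CondEquiDistrib {m : MeasurableSpace Ω} (μ : Measure Ω) (𝒢 : MeasurableSpace Ω)
    (ξ η : Ω → X) : Prop :=
  ∀ B : Set X, MeasurableSet[borel X] B →
    μ[(ξ ⁻¹' B).indicator (fun _ => (1 : ℝ)) | 𝒢]
      =ᵐ[μ] μ[(η ⁻¹' B).indicator (fun _ => (1 : ℝ)) | 𝒢]

/-- A sequence `ξ_1, …, ξ_k` is conditionally symmetric given `(ℱ_j)_{j=0}^k` if it is adapted
and each `ξ_j` and `-ξ_j` are conditionally equi-distributed given `ℱ_{j-1}`. The index `j : Fin k`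
stands for `ξ_{j+1}`. -/
def CondSymmetric {m : MeasurableSpace Ω} (μ : Measure Ω)
    (ℱ : Filtration (Fin (k + 1)) m) (ξ : Fin k → Ω → X) : Prop :=
  ∀ j : Fin k, StronglyMeasurable[ℱ j.succ] (ξ j) ∧
    CondEquiDistrib μ (ℱ j.castSucc) (ξ j) (fun ω => -ξ j ω)

/-- A strongly predictable sequence `V_1, …, V_k` of random contractions on `X`: every value is a
bounded linear operator of norm at most one, and each `V_j x` is strongly
`ℱ_{j-1}`-measurable. The index `j : Fin k` stands for `V_{j+1}`. -/
def IsPredictableContractions {m : MeasurableSpace Ω} [NormedSpace ℝ X]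
    (ℱ : Filtration (Fin (k + 1)) m) (V : Fin k → Ω → X →L[ℝ] X) : Prop :=
  ∀ j : Fin k, (∀ ω, ‖V j ω‖ ≤ 1) ∧ ∀ x : X, StronglyMeasurable[ℱ j.castSucc] fun ω => V j ω x

end Sequences

/-! ### Pathwise inequalities -/

/-! The proof has an `L²` step and a change of weights. For `p = 2`, 2-smoothness bounds
`‖f_{j+1}‖²` by `‖f_j‖²` plus a term linear in `dg_{j+1}` plus `2 D² ‖dg_{j+1}‖²`. Dividing the
linear term by the running maximum `f⋆_j` leaves a martingale difference `u_j` with `|u_j| ≤ 2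
‖dg_{j+1}‖`. A pathwise form of Doob's inequality (`sq_partialSups_le_of_recursion`) then bounds
`(f⋆)²` by a sum of squares plus a martingale transform, whose mean is zero
(`lintegral_sq_partialSups_norm_le`). For `p = 2q < 2`, divide `dg_{j+1}` by a predictable
increasing weight, the power `(1 - q)/2` of `ε + s_{j+1}²`. The weighted sequence has second moment
controlled by `E (ε + s²)^q / q`. Since the `V_j` are contractions, removing the weight costs only a
factor `2 a_n` (`norm_le_of_weighted_recursion`). Hölder's inequality and `ε → 0` finish. The
resulting constant is at most `(100 D)²` for `p`-th moments, which gives both estimates. -/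

lemma sq_partialSups_le (N : ℕ → ℝ) (h0 : N 0 = 0) (n : ℕ) :
    partialSups N n ^ 2 ≤
      4 * N n ^ 2 - 4 * ∑ i ∈ Finset.range n, partialSups N i * (N (i + 1) - N i) := by
  -- By Abel summation the right side is `∑ N (i+1) (S (i+1) - S i)`, where `S` is the running
  -- maximum. `S` moves only when `N (i+1) = S (i+1)`, and then the term is at least half the
  -- increment of `S²`.
  have key : partialSups N n ^ 2 / 2 ≤
      partialSups N n * N n - ∑ i ∈ Finset.range n, partialSups N i * (N (i + 1) - N i) := by
    induction n with
    | zero => simp [h0]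
    | succ n ih =>
      rw [Finset.sum_range_succ, partialSups_add_one]
      rcases le_total (partialSups N n) (N (n + 1)) with h | h
      · rw [sup_eq_right.2 h]
        nlinarith [sq_nonneg (N (n + 1) - partialSups N n)]
      · rw [sup_eq_left.2 h]
        nlinarith
  nlinarith [sq_nonneg (partialSups N n - 2 * N n)]

/-- Abel summation moves the differences onto the monotone `h`, whose total variation is at most `h
n`. -/
lemma abs_sum_mul_sub_le (h N : ℕ → ℝ) (R : ℝ) (hh : Monotone h) (hh0 : 0 ≤ h 0) (hN0 : N 0 = 0)
    (n : ℕ) (hR : ∀ i ≤ n, |N i| ≤ R) :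
    |∑ i ∈ Finset.range n, h i * (N (i + 1) - N i)| ≤ 2 * h n * R := by
  have hR0 : 0 ≤ R := (abs_nonneg _).trans (hR 0 n.zero_le)
  have key : |h n * N n - ∑ i ∈ Finset.range n, h i * (N (i + 1) - N i)| ≤ h n * R := by
    induction n with
    | zero => simpa [hN0] using mul_nonneg hh0 hR0
    | succ n ih =>
      have ih := ih fun i hi => hR i (hi.trans n.le_succ)
      have h1 : h (n + 1) * N (n + 1) - ∑ i ∈ Finset.range (n + 1), h i * (N (i + 1) - N i)
          = (h n * N n - ∑ i ∈ Finset.range n, h i * (N (i + 1) - N i))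
            + (h (n + 1) - h n) * N (n + 1) := by
        rw [Finset.sum_range_succ]; ring
      have h2 : 0 ≤ h (n + 1) - h n := sub_nonneg.2 (hh n.le_succ)
      rw [h1]
      refine (abs_add_le _ _).trans ?_
      rw [abs_mul, abs_of_nonneg h2]
      nlinarith [mul_le_mul_of_nonneg_left (hR (n + 1) le_rfl) h2]
  have h3 : |h n * N n| ≤ h n * R := by
    have : 0 ≤ h n := hh0.trans (hh n.zero_le)
    rw [abs_mul, abs_of_nonneg this]
    exact mul_le_mul_of_nonneg_left (hR n le_rfl) this
  rw [abs_le] at *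
  constructor <;> linarith

lemma sq_sum_range (u : ℕ → ℝ) (n : ℕ) :
    (∑ i ∈ Finset.range n, u i) ^ 2 =
      ∑ i ∈ Finset.range n, u i ^ 2
        + 2 * ∑ i ∈ Finset.range n, (∑ l ∈ Finset.range i, u l) * u i := by
  induction n with
  | zero => simp
  | succ n ih => simp only [Finset.sum_range_succ]; nlinarith

/-- The partial sums `0, u 0, u 0 + u 1, …`. -/
def partialSum (u : ℕ → ℝ) (n : ℕ) : ℝ := ∑ i ∈ Finset.range n, u i

/-- The transforming sequence in the pathwise maximal inequality `sq_partialSups_le_of_recursion`. -/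
noncomputable def maximalTransform (u : ℕ → ℝ) (n : ℕ) : ℝ :=
  64 * partialSum u n - 16 * partialSups (partialSum u) n
    + 16 * partialSups (partialSum fun i => -u i) n

/-- `maximalTransform u i` depends only on `u 0, …, u (i-1)`, so for martingale differences the last
term integrates to zero. Summing the recursion by parts gives `h² ≤ 2 h R + B`, with `R` the maximum
of `|N|`. Pathwise Doob for `N` and `-N` controls `R²`. -/
lemma sq_partialSups_le_of_recursion (φ u b : ℕ → ℝ) (hφ0 : φ 0 = 0)
    (hb : ∀ i, 0 ≤ b i)
    (hrec : ∀ i, φ (i + 1) ^ 2 ≤ φ i ^ 2 + partialSups φ i * u i + b i) (n : ℕ) :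
    partialSups φ n ^ 2 ≤
      ∑ i ∈ Finset.range n, (32 * u i ^ 2 + 2 * b i + maximalTransform u i * u i) := by
  set h : ℕ → ℝ := fun i => partialSups φ i with hdef
  set N := partialSum u with hN
  set N' := partialSum (fun i => -u i) with hN'
  have hNN' : ∀ i, N' i = - N i := fun i => by simp [hN, hN', partialSum]
  have hN0 : N 0 = 0 := by simp [hN, partialSum]
  have hNs : ∀ i, N (i + 1) - N i = u i := fun i => by
    simp [hN, partialSum, Finset.sum_range_succ]
  have hN's : ∀ i, N' (i + 1) - N' i = -u i := fun i => by rw [hNN', hNN', ← hNs]; ring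
  have hN'0 : N' 0 = 0 := by simp [hNN', hN0]
  have hmono : Monotone h := (partialSups φ).monotone
  have hh0 : h 0 = 0 := by simp [hdef, hφ0]
  set P := partialSups N n
  set Q := partialSups N' n
  have hP0 : 0 ≤ P := hN0 ▸ le_partialSups_of_le N n.zero_le
  have hQ0 : 0 ≤ Q := hN'0 ▸ le_partialSups_of_le N' n.zero_le
  have hR : ∀ i ≤ n, |N i| ≤ max P Q := fun i hi => by
    rw [abs_le']
    exact ⟨(le_partialSups_of_le N hi).trans (le_max_left _ _),
      hNN' i ▸ (le_partialSups_of_le N' hi).trans (le_max_right _ _)⟩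
  have hRsq : max P Q ^ 2 ≤ P ^ 2 + Q ^ 2 := by
    rcases max_choice P Q with h | h <;> rw [h] <;> nlinarith [sq_nonneg P, sq_nonneg Q]
  set B := ∑ i ∈ Finset.range n, b i
  have hφle : ∀ j ≤ n, φ j ^ 2 ≤ 2 * h n * max P Q + B := fun j hj => by
    have h1 : φ j ^ 2 ≤ ∑ i ∈ Finset.range j, h i * (N (i + 1) - N i)
        + ∑ i ∈ Finset.range j, b i := by
      clear hj
      induction j with
      | zero => simp [hφ0]
      | succ j ih =>
        rw [Finset.sum_range_succ, Finset.sum_range_succ, hNs]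
        linarith [hrec j]
    have h2 := (le_abs_self _).trans (abs_sum_mul_sub_le h N (max P Q) hmono hh0.ge hN0 j
      fun i hi => hR i (hi.trans hj))
    have h3 : ∑ i ∈ Finset.range j, b i ≤ B :=
      Finset.sum_le_sum_of_subset_of_nonneg (Finset.range_subset_range.2 hj) fun i _ _ => hb i
    have h4 : h j * max P Q ≤ h n * max P Q :=
      mul_le_mul_of_nonneg_right (hmono hj) (hP0.trans (le_max_left _ _))
    linarith
  have hhn : h n ^ 2 ≤ 2 * h n * max P Q + B := by
    obtain ⟨j, hj, hje⟩ : ∃ j ≤ n, h n = φ j := by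
      obtain ⟨j, hj, hje⟩ := Finset.exists_mem_eq_sup' (H := ⟨0, by simp⟩) (s := Finset.Iic n) φ
      exact ⟨j, by simpa using hj, by rw [hdef]; dsimp only; rw [partialSups_apply]; exact hje⟩
    have := hφle j hj
    rwa [hje] at this ⊢
  have hPs := sq_partialSups_le N hN0 n
  have hQs := sq_partialSups_le N' hN'0 n
  simp only [hNs, hN's, hNN' n] at hPs hQs
  have hsq : N n ^ 2 = _ := sq_sum_range u n
  change N n ^ 2 = _ + 2 * ∑ i ∈ Finset.range n, N i * u i at hsq
  have hexp : ∑ i ∈ Finset.range n, (32 * u i ^ 2 + 2 * b i + maximalTransform u i * u i)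
      = 32 * ∑ i ∈ Finset.range n, u i ^ 2 + 2 * B + 64 * ∑ i ∈ Finset.range n, N i * u i
        - 16 * ∑ i ∈ Finset.range n, partialSups N i * u i
        - 16 * ∑ i ∈ Finset.range n, partialSups N' i * -u i := by
    simp only [B, Finset.mul_sum, ← Finset.sum_add_distrib, ← Finset.sum_sub_distrib]
    refine Finset.sum_congr rfl fun i _ => ?_
    simp only [maximalTransform, ← hN, ← hN']
    ring
  rw [hexp]
  -- `2 h R ≤ h²/2 + 2 R²` gives `h² ≤ 4 R² + 2 B`. Doob gives `R² ≤ 8 N² + …`, whence `32 N²`, and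
  -- expanding `N²` yields the coefficients 32 and 64.
  nlinarith [sq_nonneg (h n - 2 * max P Q)]

/-! ### The duality map of a 2-smooth space -/

/-- `J x` is `2 ‖x‖` times a norming functional, a subgradient of `‖·‖²`. Subtracting the
subgradient inequality at `-y` from the smoothness inequality gives the upper bound. The two bounds
together force `J` to be Lipschitz; continuity is needed for measurability of `J ∘ (V f)`. -/
lemma IsTwoSmooth.exists_dualityMap {X : Type*} [NormedAddCommGroup X] [NormedSpace ℝ X] {D : ℝ}
    (hX : IsTwoSmooth X D) :
    ∃ J : X → X →L[ℝ] ℝ, Continuous J ∧ (∀ x, ‖J x‖ ≤ 2 * ‖x‖) ∧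
      ∀ x y, ‖x + y‖ ^ 2 ≤ ‖x‖ ^ 2 + J x y + 2 * D ^ 2 * ‖y‖ ^ 2 := by
  choose G hG1 hG2 using fun x : X => exists_dual_vector'' ℝ x
  simp only [RCLike.ofReal_real_eq_id, id] at hG2
  set J : X → X →L[ℝ] ℝ := fun x => (2 * ‖x‖) • G x with hJ
  have hlow : ∀ x y, ‖x‖ ^ 2 + J x y ≤ ‖x + y‖ ^ 2 := fun x y => by
    have h1 : ‖x‖ + G x y ≤ ‖x + y‖ := by
      rw [← hG2 x, ← map_add]
      exact (le_abs_self _).trans ((G x).le_of_opNorm_le (hG1 x) _ |>.trans (by simp))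
    have h2 : J x y = 2 * ‖x‖ * G x y := by simp [hJ]
    rw [h2]
    rcases le_total 0 (‖x‖ + G x y) with h | h
    · nlinarith [sq_nonneg (G x y), norm_nonneg (x + y)]
    · nlinarith [norm_nonneg x, sq_nonneg ‖x + y‖]
  have hup : ∀ x y, ‖x + y‖ ^ 2 ≤ ‖x‖ ^ 2 + J x y + 2 * D ^ 2 * ‖y‖ ^ 2 := fun x y => by
    have h1 := hlow x (-y)
    rw [map_neg, ← sub_eq_add_neg, ← sub_eq_add_neg] at h1
    linarith [hX.2 x y]
  have hnorm : ∀ x, ‖J x‖ ≤ 2 * ‖x‖ := fun x => by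
    rw [hJ, norm_smul, Real.norm_of_nonneg (by positivity)]
    exact mul_le_of_le_one_right (by positivity) (hG1 x)
  -- Go from `x` to `x + z + y` in two steps using the lower bound, and in one step using the upper
  -- bound. General `y` follows by rescaling.
  have hlip : ∀ x z y, ‖y‖ = ‖z‖ → J (x + z) y - J x y ≤ 8 * D ^ 2 * ‖z‖ * ‖y‖ := fun x z y h => by
    have h1 := hup x (z + y)
    have h2 := hlow (x + z) y
    have h3 := hlow x z
    have h4 : ‖z + y‖ ^ 2 ≤ (2 * ‖z‖) ^ 2 :=
      pow_le_pow_left₀ (norm_nonneg _) ((norm_add_le _ _).trans (by rw [h]; linarith)) 2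
    rw [map_add] at h1
    rw [← add_assoc] at h1
    rw [h] at *
    nlinarith [sq_nonneg D]
  refine ⟨J, ?_, hnorm, hup⟩
  have hL : LipschitzWith (Real.toNNReal (8 * D ^ 2)) J := by
    refine LipschitzWith.of_dist_le_mul fun a x => ?_
    rw [dist_eq_norm, dist_eq_norm, Real.coe_toNNReal _ (by positivity)]
    refine ContinuousLinearMap.opNorm_le_bound _ (by positivity) fun y => ?_
    rcases eq_or_ne (a - x) 0 with h0 | h0
    · rw [sub_eq_zero.1 h0]; simp
    rcases eq_or_ne y 0 with hy | hy
    · simp [hy]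
    have hy' : 0 < ‖y‖ := norm_pos_iff.2 hy
    have ha' : 0 < ‖a - x‖ := norm_pos_iff.2 h0
    have main : ∀ y' : X, ‖y'‖ = ‖y‖ → (J a - J x) y' ≤ 8 * D ^ 2 * ‖a - x‖ * ‖y'‖ := by
      intro y' hy'n
      set c := ‖a - x‖ / ‖y‖ with hc
      have hc0 : 0 < c := div_pos ha' hy'
      have := hlip x (a - x) (c • y') (by
        rw [norm_smul, Real.norm_of_nonneg hc0.le, hc, hy'n]; field_simp)
      rw [add_sub_cancel, map_smul, map_smul, norm_smul, Real.norm_of_nonneg hc0.le,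
        smul_eq_mul, smul_eq_mul] at this
      rw [sub_apply]
      refine le_of_mul_le_mul_left ?_ hc0
      linarith
    rw [Real.norm_eq_abs, abs_le']
    refine ⟨main y rfl, ?_⟩
    have := main (-y) (norm_neg y)
    rwa [map_neg, norm_neg] at this
  exact hL.continuous

/-! ### The maximal inequality in `L²` -/

/-- `V` is measurable only pointwise on vectors, not in operator norm, so `f` is approximated by
simple functions. -/
lemma stronglyMeasurable_clm_apply_of_forall {Ω X Y : Type*} {m : MeasurableSpace Ω}
    [NormedAddCommGroup X] [NormedSpace ℝ X] [NormedAddCommGroup Y] [NormedSpace ℝ Y]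
    {V : Ω → X →L[ℝ] Y} {f : Ω → X} (hV : ∀ x, StronglyMeasurable fun ω => V ω x)
    (hf : StronglyMeasurable f) : StronglyMeasurable fun ω => V ω (f ω) := by
  have hs : ∀ s : SimpleFunc Ω X, StronglyMeasurable fun ω => V ω (s ω) := fun s => by
    have : (fun ω => V ω (s ω)) =
        fun ω => ∑ c ∈ s.range, (s ⁻¹' {c}).indicator (fun ω => V ω c) ω := by
      funext ω
      rw [Finset.sum_eq_single (s ω)]
      · simp
      · intro c _ hc
        exact Set.indicator_of_notMem (fun h => hc (by simpa using h.symm)) _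
      · simp
    rw [this]
    exact Finset.stronglyMeasurable_fun_sum _ fun c _ => (hV c).indicator (s.measurableSet_fiber c)
  exact stronglyMeasurable_of_tendsto Filter.atTop (fun n => hs (hf.approx n))
    (tendsto_pi_nhds.2 fun ω => ((V ω).continuous.tendsto _).comp (hf.tendsto_approx ω))

section

variable {Ω : Type*} {m : MeasurableSpace Ω} {μ : Measure Ω}

lemma stronglyMeasurable_partialSups {ℱ : Filtration ℕ m} {φ : ℕ → Ω → ℝ}
    (hφ : ∀ n, StronglyMeasurable[ℱ n] (φ n)) (n : ℕ) :
    StronglyMeasurable[ℱ n] fun ω => partialSups (fun i => φ i ω) n := by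
  induction n with
  | zero => simpa using hφ 0
  | succ n ih =>
    simp only [partialSups_add_one]
    exact continuous_sup.comp_stronglyMeasurable
      ((ih.mono (ℱ.mono n.le_succ)).prodMk (hφ (n + 1)))

lemma memLp_partialSups {p : ℝ≥0∞} {φ : ℕ → Ω → ℝ} (hφ : ∀ n, MemLp (φ n) p μ) (n : ℕ) :
    MemLp (fun ω => partialSups (fun i => φ i ω) n) p μ := by
  induction n with
  | zero => simpa using hφ 0
  | succ n ih =>
    simp only [partialSups_add_one]
    exact ih.sup (hφ (n + 1))

lemma integral_clm_apply_eq_zero [IsFiniteMeasure μ] {X : Type*} [NormedAddCommGroup X]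
    [NormedSpace ℝ X] [CompleteSpace X] {𝒢 : MeasurableSpace Ω} (h𝒢 : 𝒢 ≤ m)
    {L : Ω → X →L[ℝ] ℝ} {d : Ω → X} (hL : StronglyMeasurable[𝒢] L) (hd : Integrable d μ)
    (hd0 : μ[d | 𝒢] =ᵐ[μ] 0) (hLd : Integrable (fun ω => L ω (d ω)) μ) :
    ∫ ω, L ω (d ω) ∂μ = 0 := by
  have h := condExp_bilin_of_stronglyMeasurable_left (ContinuousLinearMap.id ℝ (X →L[ℝ] ℝ))
    hL hLd hd
  simp only [ContinuousLinearMap.id_apply] at h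
  rw [← integral_condExp h𝒢, integral_congr_ae h]
  refine integral_eq_zero_of_ae ?_
  filter_upwards [hd0] with ω hω
  simp [hω]

theorem lintegral_sq_partialSups_norm_le [IsFiniteMeasure μ] {X : Type*} [NormedAddCommGroup X]
    [NormedSpace ℝ X] [CompleteSpace X] {D : ℝ} (hX : IsTwoSmooth X D) {ℱ : Filtration ℕ m}
    {f d : ℕ → Ω → X} {V : ℕ → Ω → X →L[ℝ] X}
    (hd : ∀ n, StronglyMeasurable[ℱ (n + 1)] (d n)) (hdL : ∀ n, MemLp (d n) 2 μ)
    (hd0 : ∀ n, μ[d n | ℱ n] =ᵐ[μ] 0) (hV : ∀ n ω, ‖V n ω‖ ≤ 1)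
    (hVm : ∀ n x, StronglyMeasurable[ℱ n] fun ω => V n ω x)
    (hf0 : ∀ ω, f 0 ω = 0) (hf : ∀ n ω, f (n + 1) ω = V n ω (f n ω) + d n ω) (n : ℕ) :
    ∫⁻ ω, ENNReal.ofReal (partialSups (fun i => ‖f i ω‖) n ^ 2) ∂μ ≤
      ENNReal.ofReal (132 * D ^ 2) * ∑ i ∈ Finset.range n, ∫⁻ ω, ‖d i ω‖ₑ ^ 2 ∂μ := by
  obtain ⟨J, hJc, hJn, hJ⟩ := hX.exists_dualityMap
  have hfm : ∀ n, StronglyMeasurable[ℱ n] (f n) := fun n => by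
    induction n with
    | zero => rw [show f 0 = fun _ => 0 from funext hf0]; exact stronglyMeasurable_const
    | succ n ih =>
      rw [show f (n + 1) = fun ω => V n ω (f n ω) + d n ω from funext (hf n)]
      exact ((stronglyMeasurable_clm_apply_of_forall (hVm n) ih).mono (ℱ.mono n.le_succ)).add (hd n)
  set h : ℕ → Ω → ℝ := fun n ω => partialSups (fun i => ‖f i ω‖) n with hh
  have hhm : ∀ n, StronglyMeasurable[ℱ n] (h n) :=
    stronglyMeasurable_partialSups fun n => (hfm n).norm
  have hfh : ∀ n ω, ‖f n ω‖ ≤ h n ω := fun n ω => le_partialSups (fun i => ‖f i ω‖) n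
  have hh0 : ∀ n ω, 0 ≤ h n ω := fun n ω => (norm_nonneg _).trans (hfh n ω)
  -- The normalisation gives `‖L‖ ≤ 2`. Where `h = 0` the functional `J (V f)` vanishes too, so the
  -- convention `0⁻¹ = 0` is harmless.
  set L : ℕ → Ω → X →L[ℝ] ℝ := fun n ω => (h n ω)⁻¹ • J (V n ω (f n ω)) with hLdef
  have hLm : ∀ n, StronglyMeasurable[ℱ n] (L n) := fun n =>
    (hhm n).inv₀.smul
      (hJc.comp_stronglyMeasurable (stronglyMeasurable_clm_apply_of_forall (hVm n) (hfm n)))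
  have hVf : ∀ n ω, ‖V n ω (f n ω)‖ ≤ ‖f n ω‖ := fun n ω =>
    ((V n ω).le_of_opNorm_le (hV n ω) _).trans (one_mul _).le
  have hLn : ∀ n ω, ‖L n ω‖ ≤ 2 := fun n ω => by
    rw [hLdef]
    simp only [norm_smul, norm_inv, Real.norm_of_nonneg (hh0 n ω)]
    have h1 := (hJn (V n ω (f n ω))).trans
      (mul_le_mul_of_nonneg_left ((hVf n ω).trans (hfh n ω)) two_pos.le)
    calc (h n ω)⁻¹ * ‖J (V n ω (f n ω))‖ ≤ (h n ω)⁻¹ * (2 * h n ω) :=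
          mul_le_mul_of_nonneg_left h1 (inv_nonneg.2 (hh0 n ω))
      _ = 2 * ((h n ω)⁻¹ * h n ω) := by ring
      _ ≤ 2 := by linarith [inv_mul_le_one (a := h n ω)]
  have hhL : ∀ n ω y, h n ω * L n ω y = J (V n ω (f n ω)) y := fun n ω y => by
    rcases eq_or_ne (h n ω) 0 with h0 | h0
    · have hx : ‖V n ω (f n ω)‖ = 0 :=
        le_antisymm (((hVf n ω).trans (hfh n ω)).trans h0.le) (norm_nonneg _)
      have hz : J (V n ω (f n ω)) = 0 := by
        rw [← norm_le_zero_iff]; exact (hJn _).trans (by rw [hx]; simp)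
      simp [h0, hz]
    · simp [hLdef, h0]
  set u : ℕ → Ω → ℝ := fun n ω => L n ω (d n ω) with hu
  have hule : ∀ n ω, |u n ω| ≤ 2 * ‖d n ω‖ := fun n ω => (L n ω).le_of_opNorm_le (hLn n ω) _
  have hum : ∀ n, StronglyMeasurable[ℱ (n + 1)] (u n) := fun n =>
    isBoundedBilinearMap_apply.continuous.comp_stronglyMeasurable
      (((hLm n).mono (ℱ.mono n.le_succ)).prodMk (hd n))
  have huL : ∀ n, MemLp (u n) 2 μ := fun n =>
    MemLp.of_le_mul (hdL n) ((hum n).mono (ℱ.le _)).aestronglyMeasurable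
      (ae_of_all _ (hule n))
  have hNm : ∀ v : ℕ → Ω → ℝ, (∀ n, StronglyMeasurable[ℱ (n + 1)] (v n)) →
      ∀ n, StronglyMeasurable[ℱ n] fun ω => partialSum (fun i => v i ω) n := fun v hv n =>
    Finset.stronglyMeasurable_fun_sum _ fun i hi =>
      (hv i).mono (ℱ.mono (Nat.succ_le_of_lt (Finset.mem_range.1 hi)))
  have hNL : ∀ v : ℕ → Ω → ℝ, (∀ n, MemLp (v n) 2 μ) →
      ∀ n, MemLp (fun ω => partialSum (fun i => v i ω) n) 2 μ := fun v hv n =>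
    memLp_finsetSum _ fun i _ => hv i
  set H : ℕ → Ω → ℝ := fun n ω => maximalTransform (fun i => u i ω) n with hH
  have hHm : ∀ n, StronglyMeasurable[ℱ n] (H n) := fun n =>
    (((hNm u hum n).const_mul 64).sub
      ((stronglyMeasurable_partialSups (hNm u hum) n).const_mul 16)).add
      ((stronglyMeasurable_partialSups (hNm (fun i ω => -u i ω)
        fun i => (hum i).neg) n).const_mul 16)
  have hHL : ∀ n, MemLp (H n) 2 μ := fun n =>
    (((hNL u huL n).const_mul 64).sub
      ((memLp_partialSups (hNL u huL) n).const_mul 16)).add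
      ((memLp_partialSups (hNL (fun i ω => -u i ω) fun i => (huL i).neg) n).const_mul 16)
  have hHu : ∀ n, Integrable (fun ω => H n ω * u n ω) μ := fun n => (hHL n).integrable_mul (huL n)
  -- The scalar `H n` is absorbed into the predictable functional applied to `d n`.
  have hHu0 : ∀ n, ∫ ω, H n ω * u n ω ∂μ = 0 := fun n =>
    integral_clm_apply_eq_zero (ℱ.le n) (L := fun ω => H n ω • L n ω) ((hHm n).smul (hLm n))
      ((hdL n).integrable (by norm_num)) (hd0 n) (hHu n)
  have hd2 : ∀ n, Integrable (fun ω => ‖d n ω‖ ^ 2) μ := fun n =>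
    (hdL n).integrable_norm_pow two_ne_zero
  have hD := hX.1
  -- `132 D²` comes from `32 · 2² + 2 · 2 D²` and `D ≥ 1`.
  have hpath : ∀ ω, h n ω ^ 2 ≤
      ∑ i ∈ Finset.range n, (132 * D ^ 2 * ‖d i ω‖ ^ 2 + H i ω * u i ω) := fun ω => by
    refine (sq_partialSups_le_of_recursion (fun i => ‖f i ω‖) (fun i => u i ω)
      (fun i => 2 * D ^ 2 * ‖d i ω‖ ^ 2) (by simp [hf0]) (fun i => by positivity) (fun i => ?_)
      n).trans (Finset.sum_le_sum fun i _ => ?_)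
    · have h1 := hJ (V i ω (f i ω)) (d i ω)
      rw [← hf, ← hhL] at h1
      have h2 := pow_le_pow_left₀ (norm_nonneg _) (hVf i ω) 2
      change _ ≤ _ + h i ω * L i ω (d i ω) + _
      linarith
    · have h1 : u i ω ^ 2 ≤ (2 * ‖d i ω‖) ^ 2 :=
        sq_le_sq' (abs_le.1 (hule i ω)).1 (abs_le.1 (hule i ω)).2
      have h2 : ‖d i ω‖ ^ 2 ≤ D ^ 2 * ‖d i ω‖ ^ 2 :=
        le_mul_of_one_le_left (by positivity) (one_le_pow₀ hD)
      change _ + H i ω * u i ω ≤ _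
      nlinarith
  have hint : ∀ i, Integrable (fun ω => 132 * D ^ 2 * ‖d i ω‖ ^ 2 + H i ω * u i ω) μ := fun i =>
    ((hd2 i).const_mul _).add (hHu i)
  have hintS := integrable_finsetSum (Finset.range n) fun i _ => hint i
  calc ∫⁻ ω, ENNReal.ofReal (h n ω ^ 2) ∂μ
      ≤ ∫⁻ ω, ENNReal.ofReal
          (∑ i ∈ Finset.range n, (132 * D ^ 2 * ‖d i ω‖ ^ 2 + H i ω * u i ω)) ∂μ :=
        lintegral_mono fun ω => ENNReal.ofReal_le_ofReal (hpath ω)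
    _ = ENNReal.ofReal (∫ ω,
          ∑ i ∈ Finset.range n, (132 * D ^ 2 * ‖d i ω‖ ^ 2 + H i ω * u i ω) ∂μ) :=
        (ofReal_integral_eq_lintegral_ofReal hintS
          (ae_of_all _ fun ω => (sq_nonneg _).trans (hpath ω))).symm
    _ = ENNReal.ofReal (132 * D ^ 2 * ∑ i ∈ Finset.range n, ∫ ω, ‖d i ω‖ ^ 2 ∂μ) := by
        rw [integral_finsetSum _ fun i _ => hint i, Finset.mul_sum]
        congr 1
        refine Finset.sum_congr rfl fun i _ => ?_
        rw [integral_add ((hd2 i).const_mul _) (hHu i), hHu0, add_zero, integral_const_mul]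
    _ = _ := by
        rw [ENNReal.ofReal_mul (by positivity), ENNReal.ofReal_sum_of_nonneg
          fun i _ => integral_nonneg fun ω => sq_nonneg _]
        congr 1
        refine Finset.sum_congr rfl fun i _ => ?_
        rw [ofReal_integral_eq_lintegral_ofReal (hd2 i) (ae_of_all _ fun ω => sq_nonneg _)]
        refine lintegral_congr fun ω => ?_
        rw [ENNReal.ofReal_pow (norm_nonneg _), ofReal_norm]

end

/-! ### Change of weights -/

lemma lintegral_mul_condLExp {Ω : Type*} {𝒢 m : MeasurableSpace Ω} {μ : Measure Ω}
    [IsFiniteMeasure μ] (h𝒢 : 𝒢 ≤ m) {φ g : Ω → ℝ≥0∞}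
    (hφ : Measurable φ) (hg : Measurable[𝒢] g) :
    ∫⁻ ω, g ω * condLExp 𝒢 μ φ ω ∂μ = ∫⁻ ω, g ω * φ ω ∂μ := by
  have hc : Measurable (condLExp 𝒢 μ φ) := measurable_condLExp' _ _ _
  have key : (μ.withDensity (condLExp 𝒢 μ φ)).trim h𝒢 = (μ.withDensity φ).trim h𝒢 := by
    refine @Measure.ext _ 𝒢 _ _ fun s hs => ?_
    rw [trim_measurableSet_eq h𝒢 hs, trim_measurableSet_eq h𝒢 hs, withDensity_apply _ (h𝒢 s hs),
      withDensity_apply _ (h𝒢 s hs), setLIntegral_condLExp h𝒢 _ _ hs]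
  have h1 := lintegral_trim h𝒢 (μ := μ.withDensity (condLExp 𝒢 μ φ)) hg
  have h2 := lintegral_trim h𝒢 (μ := μ.withDensity φ) hg
  rw [key, h2, lintegral_withDensity_eq_lintegral_mul _ hφ (hg.mono h𝒢 le_rfl),
    lintegral_withDensity_eq_lintegral_mul _ hc (hg.mono h𝒢 le_rfl)] at h1
  simp only [Pi.mul_apply] at h1
  simp only [mul_comm (g _)]
  exact h1.symm

/-- Concavity of `t ↦ t ^ q`, in the form of Bernoulli's inequality at `x / y`. It makes the
weighted second moments telescope. -/
lemma rpow_sub_one_mul_sub_le {q x y : ℝ} (hq0 : 0 < q) (hq1 : q < 1) (hx : 0 < x) (hxy : x ≤ y) :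
    y ^ (q - 1) * (y - x) ≤ (y ^ q - x ^ q) / q := by
  have hy : 0 < y := hx.trans_le hxy
  have h1 : (1 + (x / y - 1)) ^ q ≤ 1 + q * (x / y - 1) :=
    rpow_one_add_le_one_add_mul_self (by linarith [div_pos hx hy]) hq0.le hq1.le
  rw [add_sub_cancel, Real.div_rpow hx.le hy.le] at h1
  have hyq : 0 < y ^ q := Real.rpow_pos_of_pos hy q
  rw [div_le_iff₀ hyq] at h1
  rw [le_div_iff₀ hq0, Real.rpow_sub_one hy.ne']
  have h2 : y ^ q / y * (y - x) * q = y ^ q - (1 + q * (x / y - 1)) * y ^ q := by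
    field_simp
    ring
  linarith

/-- The error `e_j = f_j - a_j f'_j` satisfies `e_{j+1} = V_j (e_j - (a_{j+1} - a_j) f'_j)`. As
`V_j` is a contraction, `‖e_j‖` grows by at most `(a_{j+1} - a_j) R`, which telescopes. -/
lemma norm_le_of_weighted_recursion {X : Type*} [NormedAddCommGroup X] [NormedSpace ℝ X]
    {f f' d : ℕ → X} {V : ℕ → X →L[ℝ] X} {a : ℕ → ℝ} (hV : ∀ n, ‖V n‖ ≤ 1) (ha0 : ∀ n, 0 < a n)
    (ha : Monotone a) (hf0 : f 0 = 0) (hf : ∀ n, f (n + 1) = V n (f n) + d n) (hf0' : f' 0 = 0)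
    (hf' : ∀ n, f' (n + 1) = V n (f' n) + (a (n + 1))⁻¹ • d n) (n : ℕ) :
    partialSups (fun i => ‖f i‖) n ≤ 2 * a n * partialSups (fun i => ‖f' i‖) n := by
  set R := partialSups (fun i => ‖f' i‖) n
  have hR : ∀ j ≤ n, ‖f' j‖ ≤ R := fun j hj => le_partialSups_of_le (fun i => ‖f' i‖) hj
  have hR0 : 0 ≤ R := (norm_nonneg _).trans (hR 0 n.zero_le)
  have he : ∀ j ≤ n, ‖f j - a j • f' j‖ ≤ a j * R := fun j hj => by
    induction j with
    | zero => simpa [hf0, hf0'] using mul_nonneg (ha0 0).le hR0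
    | succ j ih =>
      have h1 : f (j + 1) - a (j + 1) • f' (j + 1) =
          V j ((f j - a j • f' j) - (a (j + 1) - a j) • f' j) := by
        rw [hf, hf', smul_add, smul_inv_smul₀ (ha0 _).ne']
        simp only [map_sub, map_smul, sub_smul]
        abel
      have h2 : 0 ≤ a (j + 1) - a j := sub_nonneg.2 (ha j.le_succ)
      rw [h1]
      refine ((V j).le_of_opNorm_le (hV j) _).trans ?_
      rw [one_mul]
      refine (norm_sub_le _ _).trans ?_
      rw [norm_smul, Real.norm_of_nonneg h2]
      nlinarith [ih (by omega), mul_le_mul_of_nonneg_left (hR j (by omega)) h2]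
  refine partialSups_le _ _ _ fun j hj => ?_
  have h1 : ‖f j‖ ≤ ‖f j - a j • f' j‖ + ‖a j • f' j‖ := by
    simpa using norm_add_le (f j - a j • f' j) (a j • f' j)
  rw [norm_smul, Real.norm_of_nonneg (ha0 j).le] at h1
  have h2 := mul_le_mul_of_nonneg_left (hR j hj) (ha0 j).le
  have h3 := mul_le_mul_of_nonneg_right (ha hj) hR0
  linarith [he j hj]

/-- With `4 · 132 = 528` and `(1/q)^q ≤ 2 - q` by Bernoulli, the left side is at most `1056 D²`,
uniformly in `q`. -/
lemma weight_constant_le {D q : ℝ} (hD : 1 ≤ D) (hq0 : 0 < q) (hq1 : q < 1) :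
    2 ^ (2 * q) * (132 * D ^ 2 * (1 / q)) ^ q ≤ (100 * D) ^ 2 := by
  have h1 : (1 / q) ^ q ≤ 2 := by
    have := rpow_one_add_le_one_add_mul_self (s := 1 / q - 1)
      (by linarith [one_div_pos.2 hq0]) hq0.le hq1.le
    rw [add_sub_cancel] at this
    have h : q * (1 / q - 1) = 1 - q := by field_simp
    linarith
  have hD2 : 1 ≤ D ^ 2 := one_le_pow₀ hD
  have h2 : (528 * D ^ 2) ^ q ≤ 528 * D ^ 2 := by
    simpa using Real.rpow_le_rpow_of_exponent_le (x := 528 * D ^ 2) (by linarith) hq1.le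
  rw [Real.rpow_mul two_pos.le, ← Real.mul_rpow (by positivity) (by positivity),
    show (2 : ℝ) ^ (2 : ℝ) * (132 * D ^ 2 * (1 / q)) = (528 * D ^ 2) * (1 / q) by
      norm_num; ring, Real.mul_rpow (by positivity) (by positivity)]
  have h3 : 0 ≤ (1 / q) ^ q := by positivity
  nlinarith [mul_le_mul h2 h1 h3 (by positivity : (0 : ℝ) ≤ 528 * D ^ 2)]

section

variable {Ω : Type*} {m : MeasurableSpace Ω} {μ : Measure Ω}

/-- The recursively defined sequence `f 0 = 0`, `f (n + 1) = V n (f n) + d n`. -/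
def contractionSeq {X : Type*} [NormedAddCommGroup X] [NormedSpace ℝ X]
    (V : ℕ → Ω → X →L[ℝ] X) (d : ℕ → Ω → X) : ℕ → Ω → X
  | 0 => 0
  | n + 1 => fun ω => V n ω (contractionSeq V d n ω) + d n ω

theorem lintegral_partialSups_norm_rpow_le_add [IsProbabilityMeasure μ] {X : Type*}
    [NormedAddCommGroup X] [NormedSpace ℝ X] [CompleteSpace X] {D : ℝ} (hX : IsTwoSmooth X D)
    {ℱ : Filtration ℕ m} {f d : ℕ → Ω → X} {V : ℕ → Ω → X →L[ℝ] X}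
    (hd : ∀ n, StronglyMeasurable[ℱ (n + 1)] (d n)) (hdL : ∀ n, Integrable (d n) μ)
    (hd0 : ∀ n, μ[d n | ℱ n] =ᵐ[μ] 0) (hV : ∀ n ω, ‖V n ω‖ ≤ 1)
    (hVm : ∀ n x, StronglyMeasurable[ℱ n] fun ω => V n ω x)
    (hf0 : ∀ᵐ ω ∂μ, f 0 ω = 0) (hf : ∀ n, ∀ᵐ ω ∂μ, f (n + 1) ω = V n ω (f n ω) + d n ω)
    {q : ℝ} (hq0 : 0 < q) (hq1 : q < 1)
    (hfin : ∀ n, ∫⁻ ω, (∑ i ∈ Finset.range n,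
      condLExp (ℱ i) μ (fun ω => ‖d i ω‖ₑ ^ 2) ω) ^ q ∂μ ≠ ∞) (n : ℕ) {ε : ℝ} (hε : 0 < ε) :
    ∫⁻ ω, ENNReal.ofReal (partialSups (fun i => ‖f i ω‖) n ^ (2 * q)) ∂μ ≤
      ENNReal.ofReal ((100 * D) ^ 2) * (ENNReal.ofReal (ε ^ q) + ∫⁻ ω, (∑ i ∈ Finset.range n,
        condLExp (ℱ i) μ (fun ω => ‖d i ω‖ₑ ^ 2) ω) ^ q ∂μ) := by
  set c : ℕ → Ω → ℝ≥0∞ := fun i => condLExp (ℱ i) μ (fun ω => ‖d i ω‖ₑ ^ 2) with hc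
  have hcm : ∀ i, Measurable[ℱ i] (c i) := fun i => measurable_condLExp _ _ _
  have hcfin : ∀ i, ∀ᵐ ω ∂μ, c i ω ≠ ∞ := fun i => by
    have hm : Measurable fun ω => (∑ l ∈ Finset.range (i + 1), c l ω) ^ q :=
      (Finset.measurable_fun_sum _ fun l _ => (hcm l).mono (ℱ.le l) le_rfl).pow_const q
    filter_upwards [ae_lt_top hm (hfin (i + 1))] with ω hω
    have h1 := (ENNReal.rpow_lt_top_iff_of_pos hq0).1 hω
    exact ((Finset.single_le_sum (f := fun l => c l ω) (fun _ _ => zero_le)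
      (Finset.self_mem_range_succ i)).trans_lt h1).ne
  -- `B (n + 1)` includes `c n` and is still `ℱ n`-measurable, so it may weight `d n`. The `ε` keeps
  -- it positive.
  set B : ℕ → Ω → ℝ := fun n ω => ε + ∑ l ∈ Finset.range n, (c l ω).toReal with hB
  have hBs : ∀ n ω, B (n + 1) ω = B n ω + (c n ω).toReal := fun n ω => by
    simp [hB, Finset.sum_range_succ, add_assoc]
  have hB0 : ∀ n ω, 0 < B n ω := fun n ω =>
    add_pos_of_pos_of_nonneg hε (Finset.sum_nonneg fun _ _ => ENNReal.toReal_nonneg)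
  have hBmono : ∀ ω, Monotone fun n => B n ω := fun ω =>
    monotone_nat_of_le_succ fun n => by rw [hBs]; linarith [(c n ω).toReal_nonneg]
  have hBm : ∀ n, Measurable[ℱ n] (B (n + 1)) := fun n =>
    (Finset.measurable_fun_sum _ fun l hl => ((hcm l).mono
      (ℱ.mono (Nat.lt_succ_iff.1 (Finset.mem_range.1 hl))) le_rfl).ennreal_toReal).const_add ε
  have hBm' : ∀ n, Measurable (B n) := fun n =>
    (Finset.measurable_fun_sum _ fun l _ =>
      ((hcm l).mono (ℱ.le l) le_rfl).ennreal_toReal).const_add ε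
  have hBofReal : ∀ n, ∀ᵐ ω ∂μ,
      ENNReal.ofReal (B n ω) = ENNReal.ofReal ε + ∑ l ∈ Finset.range n, c l ω := fun n => by
    filter_upwards [ae_all_iff.2 hcfin] with ω hω
    rw [hB, ENNReal.ofReal_add hε.le (Finset.sum_nonneg fun _ _ => ENNReal.toReal_nonneg),
      ENNReal.ofReal_sum_of_nonneg fun _ _ => ENNReal.toReal_nonneg]
    simp only [ENNReal.ofReal_toReal (hω _)]
  set I : ℕ → ℝ≥0∞ := fun n => ∫⁻ ω, ENNReal.ofReal (B n ω ^ q) ∂μ with hI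
  have hIle : ∀ n, I n ≤
      ENNReal.ofReal (ε ^ q) + ∫⁻ ω, (∑ l ∈ Finset.range n, c l ω) ^ q ∂μ := fun n => by
    calc I n ≤ ∫⁻ ω, (ENNReal.ofReal (ε ^ q) + (∑ l ∈ Finset.range n, c l ω) ^ q) ∂μ := by
          refine lintegral_mono_ae ?_
          filter_upwards [hBofReal n] with ω hω
          rw [← ENNReal.ofReal_rpow_of_pos (hB0 n ω), hω, ← ENNReal.ofReal_rpow_of_pos hε]
          exact ENNReal.rpow_add_le_add_rpow _ _ hq0.le hq1.le
      _ = _ := by rw [lintegral_add_left measurable_const]; simp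
  have hIfin : ∀ n, I n ≠ ∞ := fun n =>
    ((hIle n).trans_lt (ENNReal.add_lt_top.2 ⟨ENNReal.ofReal_lt_top, (hfin n).lt_top⟩)).ne
  set a : ℕ → Ω → ℝ := fun n ω => B n ω ^ ((1 - q) / 2) with ha
  have ha0 : ∀ n ω, 0 < a n ω := fun n ω => Real.rpow_pos_of_pos (hB0 n ω) _
  have hamono : ∀ ω, Monotone fun n => a n ω := fun ω i j hij =>
    Real.rpow_le_rpow (hB0 i ω).le (hBmono ω hij) (by linarith)
  set d' : ℕ → Ω → X := fun n ω => (a (n + 1) ω)⁻¹ • d n ω with hd'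
  have ham : ∀ n, Measurable[ℱ n] fun ω => (a (n + 1) ω)⁻¹ := fun n =>
    ((hBm n).pow_const _).inv
  have hd'm : ∀ n, StronglyMeasurable[ℱ (n + 1)] (d' n) := fun n =>
    ((ham n).stronglyMeasurable.mono (ℱ.mono n.le_succ)).smul (hd n)
  have hd'L2 : ∀ n, ∫⁻ ω, ‖d' n ω‖ₑ ^ 2 ∂μ ≤
      ∫⁻ ω, ENNReal.ofReal ((B (n + 1) ω ^ q - B n ω ^ q) / q) ∂μ := fun n => by
    have h1 : ∀ ω, ‖d' n ω‖ₑ ^ 2 = ENNReal.ofReal (B (n + 1) ω ^ (q - 1)) * ‖d n ω‖ₑ ^ 2 :=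
      fun ω => by
        rw [hd', enorm_smul, mul_pow, Real.enorm_of_nonneg (inv_nonneg.2 (ha0 _ _).le),
          ← ENNReal.ofReal_pow (inv_nonneg.2 (ha0 _ _).le), ha]
        congr 2
        rw [← Real.rpow_neg (hB0 _ _).le, ← Real.rpow_natCast, ← Real.rpow_mul (hB0 _ _).le]
        congr 1
        push_cast
        ring
    simp only [h1]
    rw [← lintegral_mul_condLExp (ℱ.le n)
      (((hd n).mono (ℱ.le _)).enorm.pow_const 2) ((hBm n).pow_const _).ennreal_ofReal]
    refine lintegral_mono_ae ?_
    filter_upwards [hcfin n] with ω hω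
    change _ * c n ω ≤ _
    rw [← ENNReal.ofReal_toReal hω, ← ENNReal.ofReal_mul (Real.rpow_nonneg (hB0 _ _).le _)]
    refine ENNReal.ofReal_le_ofReal ?_
    have := rpow_sub_one_mul_sub_le hq0 hq1 (hB0 n ω) (hBmono ω n.le_succ)
    rwa [Nat.succ_eq_add_one, show B (n + 1) ω - B n ω = (c n ω).toReal by rw [hBs]; ring] at this
  have hqmono : ∀ n ω, B n ω ^ q ≤ B (n + 1) ω ^ q := fun n ω =>
    Real.rpow_le_rpow (hB0 n ω).le (hBmono ω n.le_succ) hq0.le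
  have hmeas : ∀ i, Measurable fun ω => ENNReal.ofReal ((B (i + 1) ω ^ q - B i ω ^ q) / q) :=
    fun i => ((((hBm' (i + 1)).pow_const q).sub
      ((hBm' i).pow_const q)).div_const q).ennreal_ofReal
  have hsum : ∀ n, ∑ i ∈ Finset.range n, ∫⁻ ω, ‖d' i ω‖ₑ ^ 2 ∂μ ≤
      ENNReal.ofReal (1 / q) * I n := fun n => by
    calc ∑ i ∈ Finset.range n, ∫⁻ ω, ‖d' i ω‖ₑ ^ 2 ∂μ
        ≤ ∑ i ∈ Finset.range n, ∫⁻ ω, ENNReal.ofReal ((B (i + 1) ω ^ q - B i ω ^ q) / q) ∂μ :=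
          Finset.sum_le_sum fun i _ => hd'L2 i
      _ = ∫⁻ ω, ENNReal.ofReal (∑ i ∈ Finset.range n, (B (i + 1) ω ^ q - B i ω ^ q) / q) ∂μ := by
          rw [← lintegral_finsetSum _ fun i _ => hmeas i]
          refine lintegral_congr fun ω => ?_
          rw [ENNReal.ofReal_sum_of_nonneg fun i _ =>
            div_nonneg (sub_nonneg.2 (hqmono i ω)) hq0.le]
      _ ≤ ∫⁻ ω, ENNReal.ofReal (1 / q) * ENNReal.ofReal (B n ω ^ q) ∂μ := by
          refine lintegral_mono fun ω => ?_
          rw [← ENNReal.ofReal_mul (by positivity), ← Finset.sum_div,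
            Finset.sum_range_sub (fun i => B i ω ^ q), div_eq_mul_one_div, mul_comm]
          refine ENNReal.ofReal_le_ofReal (mul_le_mul_of_nonneg_left ?_ (by positivity))
          linarith [Real.rpow_nonneg (hB0 0 ω).le q]
      _ = _ := lintegral_const_mul _ ((hBm' n).pow_const q).ennreal_ofReal
  -- The `d n` are only assumed integrable; the weights produce square integrability.
  have hd'L : ∀ n, MemLp (d' n) 2 μ := fun n => by
    refine ⟨((hd'm n).mono (ℱ.le _)).aestronglyMeasurable, ?_⟩
    rw [eLpNorm_lt_top_iff_lintegral_rpow_enorm_lt_top two_ne_zero ENNReal.ofNat_ne_top]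
    simp only [ENNReal.toReal_ofNat, ENNReal.rpow_ofNat]
    refine (Finset.single_le_sum (f := fun i => ∫⁻ ω, ‖d' i ω‖ₑ ^ 2 ∂μ) (fun _ _ => zero_le)
      (Finset.self_mem_range_succ n)).trans_lt ((hsum (n + 1)).trans_lt ?_)
    exact ENNReal.mul_lt_top ENNReal.ofReal_lt_top (hIfin _).lt_top
  have hd'0 : ∀ n, μ[d' n | ℱ n] =ᵐ[μ] 0 := fun n => by
    have h1 := condExp_smul_of_aestronglyMeasurable_left (μ := μ)
      (ham n).stronglyMeasurable.aestronglyMeasurable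
      ((hd'L n).integrable (by norm_num)) (hdL n)
    refine h1.trans ?_
    filter_upwards [hd0 n] with ω hω
    simp [hω]
  set f' := contractionSeq V d' with hf'
  have hL2 := lintegral_sq_partialSups_norm_le hX hd'm hd'L hd'0 hV hVm (f := f')
    (fun ω => rfl) (fun n ω => rfl) n
  set R : Ω → ℝ := fun ω => partialSups (fun i => ‖f' i ω‖) n with hR
  have hR0 : ∀ ω, 0 ≤ R ω := fun ω =>
    (norm_nonneg _).trans (le_partialSups (fun i => ‖f' i ω‖) n)
  have hRm : Measurable R := by
    have hf'm : ∀ n, StronglyMeasurable[ℱ n] (f' n) := fun n => by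
      induction n with
      | zero => exact stronglyMeasurable_const
      | succ n ih =>
        exact ((stronglyMeasurable_clm_apply_of_forall (hVm n) ih).mono (ℱ.mono n.le_succ)).add
          (hd'm n)
    exact ((stronglyMeasurable_partialSups fun n => (hf'm n).norm) n).mono (ℱ.le n) |>.measurable
  have hpath : ∀ᵐ ω ∂μ, ENNReal.ofReal (partialSups (fun i => ‖f i ω‖) n ^ (2 * q)) ≤
      ENNReal.ofReal (2 ^ (2 * q)) *
        (ENNReal.ofReal (B n ω ^ q) ^ (1 - q) * ENNReal.ofReal (R ω ^ 2) ^ q) := by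
    filter_upwards [hf0, ae_all_iff.2 hf] with ω h0 h1
    have h2 := norm_le_of_weighted_recursion (f := fun i => f i ω) (f' := fun i => f' i ω)
      (d := fun i => d i ω) (V := fun i => V i ω) (a := fun i => a i ω) (fun i => hV i ω)
      (fun i => ha0 i ω) (hamono ω) h0 h1 rfl (fun i => rfl) n
    change _ ≤ 2 * a n ω * R ω at h2
    have h3 : (0 : ℝ) ≤ partialSups (fun i => ‖f i ω‖) n :=
      (norm_nonneg _).trans (le_partialSups (fun i => ‖f i ω‖) n)
    rw [ENNReal.ofReal_rpow_of_nonneg (Real.rpow_nonneg (hB0 _ _).le _) (by linarith),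
      ENNReal.ofReal_rpow_of_nonneg (sq_nonneg _) hq0.le, ← ENNReal.ofReal_mul (by
        exact Real.rpow_nonneg (Real.rpow_nonneg (hB0 _ _).le _) _),
      ← ENNReal.ofReal_mul (by positivity)]
    refine ENNReal.ofReal_le_ofReal ((Real.rpow_le_rpow h3 h2 (by positivity)).trans_eq ?_)
    rw [Real.mul_rpow (mul_nonneg two_pos.le (ha0 n ω).le) (hR0 ω),
      Real.mul_rpow two_pos.le (ha0 n ω).le, ha, ← Real.rpow_mul (hB0 _ _).le,
      ← Real.rpow_mul (hB0 _ _).le, ← Real.rpow_natCast, ← Real.rpow_mul (hR0 ω), mul_assoc]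
    congr 3
    · ring_nf
  have hD := hX.1
  calc ∫⁻ ω, ENNReal.ofReal (partialSups (fun i => ‖f i ω‖) n ^ (2 * q)) ∂μ
      ≤ ∫⁻ ω, ENNReal.ofReal (2 ^ (2 * q)) *
        (ENNReal.ofReal (B n ω ^ q) ^ (1 - q) * ENNReal.ofReal (R ω ^ 2) ^ q) ∂μ :=
        lintegral_mono_ae hpath
    _ = ENNReal.ofReal (2 ^ (2 * q)) *
        ∫⁻ ω, ENNReal.ofReal (B n ω ^ q) ^ (1 - q) * ENNReal.ofReal (R ω ^ 2) ^ q ∂μ :=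
        lintegral_const_mul' _ _ ENNReal.ofReal_ne_top
    -- Hölder's inequality with exponents `1/(1-q)` and `1/q`; the weight was chosen so that its
    -- factor is `I n`, which also bounds the second moment.
    _ ≤ ENNReal.ofReal (2 ^ (2 * q)) *
        (I n ^ (1 - q) * (∫⁻ ω, ENNReal.ofReal (R ω ^ 2) ∂μ) ^ q) := by
        gcongr
        exact ENNReal.lintegral_mul_norm_pow_le
          ((hBm' n).pow_const q).ennreal_ofReal.aemeasurable
          (hRm.pow_const 2).ennreal_ofReal.aemeasurable (by linarith) hq0.le (by ring)
    _ ≤ ENNReal.ofReal (2 ^ (2 * q)) * (I n ^ (1 - q) *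
        (ENNReal.ofReal (132 * D ^ 2) * (ENNReal.ofReal (1 / q) * I n)) ^ q) := by
        gcongr
        exact hL2.trans (by gcongr; exact hsum n)
    _ = ENNReal.ofReal (2 ^ (2 * q) * (132 * D ^ 2 * (1 / q)) ^ q) * I n := by
        rw [← mul_assoc (ENNReal.ofReal (132 * D ^ 2)), ← ENNReal.ofReal_mul (by positivity),
          ENNReal.mul_rpow_of_nonneg _ _ hq0.le, ENNReal.ofReal_rpow_of_pos (by positivity),
          ENNReal.ofReal_mul (by positivity)]
        have h1 : I n ^ (1 - q) * I n ^ q = I n := by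
          rw [← ENNReal.rpow_add_of_nonneg _ _ (by linarith) hq0.le]
          simp
        conv_rhs => rw [← h1]
        ring
    _ ≤ _ := by
        gcongr
        · exact weight_constant_le hD hq0 hq1
        · exact hIle n

theorem lintegral_partialSups_norm_rpow_le [IsProbabilityMeasure μ] {X : Type*}
    [NormedAddCommGroup X] [NormedSpace ℝ X] [CompleteSpace X] {D : ℝ} (hX : IsTwoSmooth X D)
    {ℱ : Filtration ℕ m} {f d : ℕ → Ω → X} {V : ℕ → Ω → X →L[ℝ] X}
    (hd : ∀ n, StronglyMeasurable[ℱ (n + 1)] (d n)) (hdL : ∀ n, Integrable (d n) μ)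
    (hd0 : ∀ n, μ[d n | ℱ n] =ᵐ[μ] 0) (hV : ∀ n ω, ‖V n ω‖ ≤ 1)
    (hVm : ∀ n x, StronglyMeasurable[ℱ n] fun ω => V n ω x)
    (hf0 : ∀ᵐ ω ∂μ, f 0 ω = 0) (hf : ∀ n, ∀ᵐ ω ∂μ, f (n + 1) ω = V n ω (f n ω) + d n ω)
    {q : ℝ} (hq0 : 0 < q) (hq1 : q < 1)
    (hfin : ∀ n, ∫⁻ ω, (∑ i ∈ Finset.range n,
      condLExp (ℱ i) μ (fun ω => ‖d i ω‖ₑ ^ 2) ω) ^ q ∂μ ≠ ∞) (n : ℕ) :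
    ∫⁻ ω, ENNReal.ofReal (partialSups (fun i => ‖f i ω‖) n ^ (2 * q)) ∂μ ≤
      ENNReal.ofReal ((100 * D) ^ 2) * ∫⁻ ω, (∑ i ∈ Finset.range n,
        condLExp (ℱ i) μ (fun ω => ‖d i ω‖ₑ ^ 2) ω) ^ q ∂μ := by
  set S := ∫⁻ ω, (∑ i ∈ Finset.range n, condLExp (ℱ i) μ (fun ω => ‖d i ω‖ₑ ^ 2) ω) ^ q ∂μ
  have hlim : Filter.Tendsto (fun ε : ℝ => ENNReal.ofReal ((100 * D) ^ 2) *
      (ENNReal.ofReal (ε ^ q) + S)) (nhdsWithin 0 (Set.Ioi 0))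
      (nhds (ENNReal.ofReal ((100 * D) ^ 2) * (ENNReal.ofReal 0 + S))) := by
    refine ENNReal.Tendsto.const_mul (Filter.Tendsto.add (ENNReal.tendsto_ofReal ?_)
      tendsto_const_nhds) (Or.inr ENNReal.ofReal_ne_top)
    have h : Filter.Tendsto (fun ε : ℝ => ε ^ q) (nhds 0) (nhds (0 ^ q)) :=
      (Real.continuousAt_rpow_const 0 q (Or.inr hq0.le))
    rw [Real.zero_rpow hq0.ne'] at h
    exact h.mono_left nhdsWithin_le_nhds
  rw [ENNReal.ofReal_zero, zero_add] at hlim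
  refine ge_of_tendsto hlim ?_
  filter_upwards [self_mem_nhdsWithin] with ε hε
  exact lintegral_partialSups_norm_rpow_le_add hX hd hdL hd0 hV hVm hf0 hf hq0 hq1 hfin n hε

end

/-! ### From finite to infinite index sets -/

/-- The index `min n k`, as an element of `Fin (k + 1)`. -/
def stopIndex (k n : ℕ) : Fin (k + 1) := ⟨min n k, Nat.lt_succ_of_le (min_le_right n k)⟩

lemma stopIndex_mono (k : ℕ) : Monotone (stopIndex k) := fun _ _ h =>
  min_le_min_right k h

lemma stopIndex_castSucc {k : ℕ} (j : Fin k) : stopIndex k j = j.castSucc :=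
  Fin.ext (min_eq_left j.2.le)

lemma stopIndex_succ {k : ℕ} (j : Fin k) : stopIndex k (j + 1) = j.succ :=
  Fin.ext (min_eq_left j.2)

lemma stopIndex_of_le {k n : ℕ} (h : k ≤ n) : stopIndex k n = Fin.last k :=
  Fin.ext (min_eq_right h)

lemma stopIndex_val {k : ℕ} (i : Fin (k + 1)) : stopIndex k i = i :=
  Fin.ext (min_eq_left (Nat.lt_succ_iff.1 i.2))

/-- The extension of a finite filtration to `ℕ` that is constant from the last index on. -/
def stopFiltration {Ω : Type*} {m : MeasurableSpace Ω} {k : ℕ}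
    (ℱ : Filtration (Fin (k + 1)) m) : Filtration ℕ m where
  seq n := ℱ (stopIndex k n)
  mono' _ _ h := ℱ.mono (stopIndex_mono k h)
  le' n := ℱ.le (stopIndex k n)

theorem eLpNorm_maxFun_le {Ω : Type*} {m : MeasurableSpace Ω} (μ : Measure Ω)
    [IsProbabilityMeasure μ] {X : Type*} [NormedAddCommGroup X] [NormedSpace ℝ X] [CompleteSpace X]
    {D : ℝ} (hX : IsTwoSmooth X D) {k : ℕ} {ℱ : Filtration (Fin (k + 1)) m}
    {f g : Fin (k + 1) → Ω → X} {V : Fin k → Ω → X →L[ℝ] X} (hg : Martingale g ℱ μ)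
    (hV : IsPredictableContractions ℱ V) (hf0 : f 0 =ᵐ[μ] 0)
    (hfg : ∀ j : Fin k, ∀ᵐ ω ∂μ, f j.succ ω = V j ω (f j.castSucc ω) + diffSeq g j ω)
    {p : ℝ} (hp0 : 0 < p) (hp2 : p < 2) :
    eLpNorm (maxFun f) (ENNReal.ofReal p) μ
      ≤ ENNReal.ofReal ((100 * D) ^ (2 / p))
        * eLpNorm (condSquareFun μ ℱ g) (ENNReal.ofReal p) μ := by
  have hD : 0 < 100 * D := by linarith [hX.1]
  have hp : ENNReal.ofReal p ≠ 0 := by simpa using hp0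
  rw [eLpNorm_eq_lintegral_rpow_enorm_toReal hp ENNReal.ofReal_ne_top,
    eLpNorm_eq_lintegral_rpow_enorm_toReal hp ENNReal.ofReal_ne_top,
    ENNReal.toReal_ofReal hp0.le]
  set F : ℕ → Ω → X := fun n => f (stopIndex k n) with hF
  set d : ℕ → Ω → X := fun n ω => g (stopIndex k (n + 1)) ω - g (stopIndex k n) ω with hd
  -- Past `k` the sequence is frozen: identity operator and zero increments preserve the recursion.
  set W : ℕ → Ω → X →L[ℝ] X := fun n =>
    if h : n < k then V ⟨n, h⟩ else fun _ => ContinuousLinearMap.id ℝ X with hW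
  set 𝒢 := stopFiltration ℱ with h𝒢
  set c : ℕ → Ω → ℝ≥0∞ := fun i => condLExp (𝒢 i) μ (fun ω => ‖d i ω‖ₑ ^ 2) with hc
  have hd_ge : ∀ n, k ≤ n → ∀ ω, d n ω = 0 := fun n hn ω => by
    simp only [hd, stopIndex_of_le hn, stopIndex_of_le (hn.trans n.le_succ), sub_self]
  have hd_lt : ∀ j : Fin k, d j = diffSeq g j := fun j => by
    funext ω
    simp only [hd, diffSeq, stopIndex_castSucc, stopIndex_succ]
  have hc_ge : ∀ n, k ≤ n → c n = 0 := fun n hn => by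
    have h0 : (fun ω => ‖d n ω‖ₑ ^ 2) = 0 := funext fun ω => by simp [hd_ge n hn ω]
    rw [hc]
    simp only [h0, condLExp_zero]
  have hcsum : ∀ ω, condSquareFun μ ℱ g ω = (∑ i ∈ Finset.range k, c i ω) ^ (1 / 2 : ℝ) :=
    fun ω => by
      rw [condSquareFun, Finset.sum_range]
      congr 1
      refine Finset.sum_congr rfl fun j _ => ?_
      simp only [hc, hd_lt]
      change condLExp (ℱ j.castSucc) _ _ _ = condLExp (ℱ (stopIndex k j)) _ _ _
      rw [stopIndex_castSucc]
  have hsquare : ∫⁻ ω, ‖condSquareFun μ ℱ g ω‖ₑ ^ p ∂μ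
      = ∫⁻ ω, (∑ i ∈ Finset.range k, c i ω) ^ (p / 2) ∂μ := by
    refine lintegral_congr fun ω => ?_
    rw [enorm_eq_self, hcsum, ← ENNReal.rpow_mul]
    congr 1
    ring
  set S := ∫⁻ ω, (∑ i ∈ Finset.range k, c i ω) ^ (p / 2) ∂μ with hS
  rw [hsquare]
  -- If `S = ∞` the right side is infinite, as its constant is positive.
  rcases eq_or_ne S ∞ with hSt | hSt
  · rw [hSt, ENNReal.top_rpow_of_pos (by positivity), ENNReal.mul_top]
    · exact le_top
    · simpa using Real.rpow_pos_of_pos hD _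
  have hfin : ∀ n, ∫⁻ ω, (∑ i ∈ Finset.range n, c i ω) ^ (p / 2) ∂μ ≠ ∞ := fun n => by
    refine ((lintegral_mono fun ω => ENNReal.rpow_le_rpow ?_ (by positivity)).trans_lt
      hSt.lt_top).ne
    rcases le_total n k with hn | hn
    · exact Finset.sum_le_sum_of_subset (Finset.range_subset_range.2 hn)
    · refine (Finset.sum_subset (Finset.range_subset_range.2 hn) fun i _ hi => ?_).ge
      rw [hc_ge i (by simpa using hi)]
      rfl
  have hgm : ∀ n, StronglyMeasurable[𝒢 n] (g (stopIndex k n)) := fun n =>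
    hg.stronglyMeasurable (stopIndex k n)
  have hWrec : ∀ n, ∀ᵐ ω ∂μ, F (n + 1) ω = W n ω (F n ω) + d n ω := fun n => by
    rcases lt_or_ge n k with hn | hn
    · filter_upwards [hfg ⟨n, hn⟩] with ω hω
      have h1 := stopIndex_castSucc ⟨n, hn⟩
      have h2 := stopIndex_succ ⟨n, hn⟩
      have h3 := congrFun (hd_lt ⟨n, hn⟩) ω
      simp only at h1 h2 h3
      simp only [hF, h1, h2, h3, hW, hn, dite_true, hω]
    · refine ae_of_all _ fun ω => ?_
      simp only [hF, hW, hd_ge n hn, stopIndex_of_le hn, stopIndex_of_le (hn.trans n.le_succ),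
        hn.not_gt, dite_false]
      simp
  have hmain := lintegral_partialSups_norm_rpow_le (μ := μ) hX (ℱ := 𝒢) (f := F) (d := d) (V := W)
    (fun n => (hgm (n + 1)).sub ((hgm n).mono (𝒢.mono n.le_succ)))
    (fun n => (hg.integrable _).sub (hg.integrable _))
    (fun n => by
      refine (condExp_sub (hg.integrable _) (hg.integrable _) _).trans ?_
      filter_upwards [hg.condExp_ae_eq (stopIndex_mono k n.le_succ),
        hg.condExp_ae_eq (le_refl (stopIndex k n))] with ω h1 h2
      exact sub_eq_zero.2 (h1.trans h2.symm))
    (fun n ω => by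
      rcases lt_or_ge n k with hn | hn
      · simpa only [hW, hn, dite_true] using (hV ⟨n, hn⟩).1 ω
      · simpa only [hW, hn.not_gt, dite_false] using ContinuousLinearMap.norm_id_le)
    (fun n x => by
      rcases lt_or_ge n k with hn | hn
      · have h := (hV ⟨n, hn⟩).2 x
        rw [← stopIndex_castSucc] at h
        simp only [hW, hn, dite_true]
        exact h
      · simpa only [hW, hn.not_gt, dite_false] using stronglyMeasurable_const)
    hf0 hWrec (half_pos hp0) (by linarith) hfin k
  change _ ≤ _ * S at hmain
  have hmax : ∫⁻ ω, ‖maxFun f ω‖ₑ ^ p ∂μ ≤ ENNReal.ofReal ((100 * D) ^ 2) * S := by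
    refine (lintegral_mono fun ω => ?_).trans hmain
    have h0 : 0 ≤ maxFun f ω :=
      (norm_nonneg (f 0 ω)).trans (Finset.le_sup' (fun i => ‖f i ω‖) (Finset.mem_univ 0))
    rw [Real.enorm_of_nonneg h0, ENNReal.ofReal_rpow_of_nonneg h0 hp0.le,
      mul_div_cancel₀ p two_ne_zero]
    refine ENNReal.ofReal_le_ofReal (Real.rpow_le_rpow h0 (Finset.sup'_le _ _ fun i _ => ?_) hp0.le)
    have h1 := le_partialSups_of_le (fun n => ‖F n ω‖) (Nat.lt_succ_iff.1 i.2)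
    simpa only [hF, stopIndex_val] using h1
  calc (∫⁻ ω, ‖maxFun f ω‖ₑ ^ p ∂μ) ^ (1 / p)
      ≤ (ENNReal.ofReal ((100 * D) ^ 2) * S) ^ (1 / p) :=
        ENNReal.rpow_le_rpow hmax (by positivity)
    _ = ENNReal.ofReal ((100 * D) ^ (2 / p)) * S ^ (1 / p) := by
        rw [ENNReal.mul_rpow_of_nonneg _ _ (by positivity),
          ENNReal.ofReal_rpow_of_pos (by positivity), ← Real.rpow_natCast, ← Real.rpow_mul hD.le]
        congr 3
        push_cast
        ring

theorem corollary3p6 {Ω : Type*} {m : MeasurableSpace Ω} (μ : Measure Ω) [IsProbabilityMeasure μ]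
    {X : Type*} [NormedAddCommGroup X] [NormedSpace ℝ X] [CompleteSpace X]
    (D : ℝ) (hX : IsTwoSmooth X D)
    (k : ℕ) (ℱ : Filtration (Fin (k + 1)) m)
    (f g : Fin (k + 1) → Ω → X) (V : Fin k → Ω → X →L[ℝ] X)
    (hf : StronglyAdapted ℱ f) (hg : Martingale g ℱ μ)
    (hV : IsPredictableContractions ℱ V)
    (hf0 : f 0 =ᵐ[μ] 0) (hg0 : g 0 =ᵐ[μ] 0)
    (hfg : ∀ j : Fin k, ∀ᵐ ω ∂μ, f j.succ ω = V j ω (f j.castSucc ω) + diffSeq g j ω)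
    (p : ℝ) (hp0 : 0 < p) (hp2 : p < 2) :
    eLpNorm (maxFun f) (ENNReal.ofReal p) μ
        ≤ ENNReal.ofReal ((300 * D) ^ (2 / p))
          * eLpNorm (condSquareFun μ ℱ g) (ENNReal.ofReal p) μ ∧
      (CondSymmetric μ ℱ (diffSeq g) →
        eLpNorm (maxFun f) (ENNReal.ofReal p) μ
          ≤ ENNReal.ofReal ((100 * D) ^ (2 / p))
            * eLpNorm (condSquareFun μ ℱ g) (ENNReal.ofReal p) μ) := by
  have h := eLpNorm_maxFun_le μ hX hg hV hf0 hfg hp0 hp2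
  refine ⟨h.trans ?_, fun _ => h⟩
  have hD : 0 ≤ D := zero_le_one.trans hX.1
  gcongr
  norm_num
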